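/- **Theorem 2.** Let $B$ be the set of positive nonincreasing functions $\psi$ on $[1,\infty)$ for which there is $K>0$ with $\psi(t)/\psi(2t)\le K$ for all $t\ge 1$. Let $\Theta_1$ be the set of continuous nonincreasing functions $\psi$ on $[1,\infty)$ for which there are $\alpha>1$ and $K>0$ with $t_1^{\alpha}\psi(t_1)\le K\,t_2^{\alpha}\psi(t_2)$ for all $t_1>t_2\ge 1$. For $\psi\in B\cap\Theta_1$ and $\beta\in\mathbb R$, let $\Psi_\beta$ be the $2\pi$-periodic function, summable over a period, with Fourier series $\sum_{k=1}^{\infty}\psi(k)\cos\left(kt-\frac{\beta\pi}{2}\right)$ (under these hypotheses $\Psi_\beta\in L_\infty$). Let $C^{\psi}_{\beta,1}$ be the class of continuous real-valued functions of the form $$f(x)=\frac{a_0}{2}+\frac1\pi\int_{-\pi}^{\pi}\Psi_\beta(x-t)\varphi(t)\,dt,\qquad x\in\mathbb R,$$ where $a_0\in\mathbb R$ and $\varphi$ is a real-valued, $2\pi$-periodic function, summable over a period, with $\int_{-\pi}^{\pi}\varphi(t)\,dt=0$ and $\int_{-\pi}^{\pi}|\varphi(t)|\,dt\le 1$. For $n\in\mathbb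 N=\{1,2,\dots\}$ put $$E_n(C^{\psi}_{\beta,1})_C=\sup_{f\in C^{\psi}_{\beta,1}}\ \inf_{t_{n-1}}\|f-t_{n-1}\|_C,\qquad \mathcal E_n(C^{\psi}_{\beta,1})_C=\sup_{f\in C^{\psi}_{\beta,1}}\|f-S_{n-1}(f)\|_C,$$ where $\|g\|_C=\max_{t}|g(t)|$, the infimum is over all real trigonometric polynomials $t_{n-1}$ of order at most $n-1$, and $S_{n-1}(f)$ is the Fourier sum of $f$ of order $n-1$. Let $\psi\in B\cap\Theta_1$, and suppose that, with $\Delta^2(1/\psi(k))=\frac1{\psi(k)}-\frac2{\psi(k+1)}+\frac1{\psi(k+2)}$, either $\Delta^2(1/\psi(k))\ge 0$ for all $k\in\mathbb N$ or $\Delta^2(1/\psi(k))\le 0$ for all $k\in\mathbb N$. Then there exist positive numbers $K^{(1)}_\psi$ and $K^{(2)}_\psi$, depending only on $\psi$, such that for all $\beta\in\mathbb R$ and all $n\in\mathbb N$ $$K^{(2)}_\psi\,\psi(n)\,n\le E_n(C^{\psi}_{\beta,1})_C\le \mathcal E_n(C^{\psi}_{\beta,1})_C\le K^{(1)}_\psi\,\psi(n)\,n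 .$$ -/

import Mathlib

open MeasureTheory Real
open scoped ENNReal

namespace PsiBeta

noncomputable section

/-- Cosine Fourier coefficient `a_k(f) = (1/π) ∫_{-π}^{π} f(t) cos(kt) dt`. -/
def cosCoeff (f : ℝ → ℝ) (k : ℕ) : ℝ :=
  (1 / π) * ∫ t in (-π)..π, f t * cos (k * t)

/-- Sine Fourier coefficient `b_k(f) = (1/π) ∫_{-π}^{π} f(t) sin(kt) dt`. -/
def sinCoeff (f : ℝ → ℝ) (k : ℕ) : ℝ :=
  (1 / π) * ∫ t in (-π)..π, f t * sin (k * t)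

/-- The real trigonometric polynomial of order at most `m`
`a_0 / 2 + ∑_{k=1}^{m} (a_k cos kx + b_k sin kx)`. -/
def trigPoly (m : ℕ) (a b : ℕ → ℝ) (x : ℝ) : ℝ :=
  a 0 / 2 + ∑ k ∈ Finset.Icc 1 m, (a k * cos (k * x) + b k * sin (k * x))

/-- The space of real trigonometric polynomials of order at most `m`. -/
def trigPolys (m : ℕ) : Set (ℝ → ℝ) :=
  {T | ∃ a b : ℕ → ℝ, T = trigPoly m a b}

/-- The Fourier sum `S_m(f; ·)` of order `m`. -/
def fourierSum (m : ℕ) (f : ℝ → ℝ) : ℝ → ℝ :=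
  trigPoly m (cosCoeff f) (sinCoeff f)

/-- The uniform norm, with values in `[0, ∞]`. -/
def normC (g : ℝ → ℝ) : ℝ≥0∞ := ⨆ t : ℝ, ‖g t‖ₑ

/-- Lebesgue measure on one period. -/
def periodMeasure : Measure ℝ := volume.restrict (Set.Ioc (-π) π)

/-- `Ψ` is a `2π`-periodic summable function whose Fourier series is
`∑_{k ≥ 1} ψ(k) cos(kt - βπ/2)
  = ∑_{k ≥ 1} (ψ(k) cos(βπ/2) cos kt + ψ(k) sin(βπ/2) sin kt)`. -/
structure IsKernel (ψ : ℝ → ℝ) (β : ℝ) (Ψ : ℝ → ℝ) : Prop where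
  periodic : Function.Periodic Ψ (2 * π)
  integrable : Integrable Ψ periodMeasure
  cosCoeff_zero : cosCoeff Ψ 0 = 0
  cosCoeff_eq : ∀ k : ℕ, 1 ≤ k → cosCoeff Ψ k = ψ k * cos (β * π / 2)
  sinCoeff_eq : ∀ k : ℕ, 1 ≤ k → sinCoeff Ψ k = ψ k * sin (β * π / 2)

/-- The class `C^ψ_{β,p}`: continuous functions
`f(x) = a₀/2 + (1/π) ∫_{-π}^{π} Ψ_β(x - t) φ(t) dt`
with `φ` a `2π`-periodic function of mean zero, `‖φ‖_p ≤ 1`, and `Ψ_β ∈ L_{p'}`,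
`1/p + 1/p' = 1`. -/
def classC (ψ : ℝ → ℝ) (β : ℝ) (p : ℝ≥0∞) : Set (ℝ → ℝ) :=
  {f | Continuous f ∧ ∃ (Ψ φ : ℝ → ℝ) (a₀ : ℝ),
    IsKernel ψ β Ψ ∧ MemLp Ψ p.conjExponent periodMeasure ∧
    Function.Periodic φ (2 * π) ∧ MemLp φ p periodMeasure ∧
    eLpNorm φ p periodMeasure ≤ 1 ∧ (∫ t in (-π)..π, φ t) = 0 ∧
    ∀ x, f x = a₀ / 2 + (1 / π) * ∫ t in (-π)..π, Ψ (x - t) * φ t}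

/-- `𝓔_n(N)_C`: the supremum over `f ∈ N` of `‖f - S_{n-1}(f)‖_C` (for `n ≥ 1`). -/
def fourierApprox (n : ℕ) (N : Set (ℝ → ℝ)) : ℝ≥0∞ :=
  ⨆ f ∈ N, normC (fun x => f x - fourierSum (n - 1) f x)

/-- `E_n(N)_C`: the supremum over `f ∈ N` of the distance from `f` to the trigonometric
polynomials of order at most `n - 1` in the uniform norm (for `n ≥ 1`). -/
def bestApprox (n : ℕ) (N : Set (ℝ → ℝ)) : ℝ≥0∞ :=
  ⨆ f ∈ N, ⨅ T ∈ trigPolys (n - 1), normC (fun x => f x - T x)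

/-- The set `Θ_p`: continuous nonincreasing functions `ψ` on `[1, ∞)` such that
`t ^ α * ψ t` is almost decreasing for some `α > 1/p`. Only values on `[1, ∞)` matter. -/
def Theta (p : ℝ) : Set (ℝ → ℝ) :=
  {ψ | ContinuousOn ψ (Set.Ici 1) ∧ AntitoneOn ψ (Set.Ici 1) ∧
    ∃ α : ℝ, 1 / p < α ∧ ∃ K : ℝ, 0 < K ∧
      ∀ t₁ t₂ : ℝ, 1 ≤ t₂ → t₂ < t₁ → t₁ ^ α * ψ t₁ ≤ K * (t₂ ^ α * ψ t₂)}

/-- The set `B`: positive nonincreasing functions `ψ` on `[1, ∞)` with `ψ(t)/ψ(2t)` bounded.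
Only values on `[1, ∞)` matter. -/
def setB : Set (ℝ → ℝ) :=
  {ψ | (∀ t : ℝ, 1 ≤ t → 0 < ψ t) ∧ AntitoneOn ψ (Set.Ici 1) ∧
    ∃ K : ℝ, 0 < K ∧ ∀ t : ℝ, 1 ≤ t → ψ t / ψ (2 * t) ≤ K}

/-- `Δ²(1/ψ(k)) = 1/ψ(k) - 2/ψ(k+1) + 1/ψ(k+2)`. -/
def secondDiffInv (ψ : ℝ → ℝ) (k : ℕ) : ℝ :=
  1 / ψ k - 2 / ψ (k + 1) + 1 / ψ (k + 2)

end

end PsiBeta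

open scoped Pointwise

namespace PsiBeta

/-! ### Orthogonality of the trigonometric system -/

/-! Upper bound: since `t ^ α * ψ t` is almost decreasing for some `α > 1`, comparison with an
integral gives `∑_{k ≥ n} ψ(k) ≤ C n ψ(n)` (`exists_tail_bound`). So the series of `Ψ_β` converges
absolutely, and `Ψ_β` agrees a.e. with its continuous sum. The Fourier coefficients of `φ` are at
most `1` in absolute value, hence every `f` in the class is a trigonometric series with cosine and
sine coefficients bounded by `ψ(k)` (`exists_trigSeries_of_mem_classC`), and its Fourier remainder
is at most twice the tail.

Lower bound, by duality: take for `φ` a normalized Fejér kernel modulated to frequencies strictly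
between `n` and `3n`. It has mean zero and `L₁` norm at most `1`. Test the resulting `f` against a
modulated Fejér kernel `g` whose phase matches that of `f`. Then `g` annihilates polynomials of
order `n - 1` and `∫|g| ≤ 2πn`, while `∫ f g` is a sum of values of `ψ` over coinciding frequencies
with no cancellation, whatever `β` is. There are at least `n³/2` coincidences, and the doubling
condition makes `ψ` comparable to `ψ(n)` on these frequencies, so the distance from `f` is at least
a constant times `n ψ(n)`. -/

lemma integral_cos_int_mul_add (m : ℤ) (c : ℝ) :
    ∫ t in (-π)..π, cos (m * t + c) = if m = 0 then 2 * π * cos c else 0 := by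
  split_ifs with h
  · subst h
    simp only [Int.cast_zero, zero_mul, zero_add, intervalIntegral.integral_const, smul_eq_mul]
    ring
  · have hm : (m : ℝ) ≠ 0 := by exact_mod_cast h
    rw [intervalIntegral.integral_comp_mul_add (fun x => cos x) hm, integral_cos,
      sin_add, sin_add, mul_neg, sin_neg, cos_neg, sin_int_mul_pi]
    simp

/-- Arbitrary phases let one formula cover cosines, sines (phase `-π/2`) and the shift `βπ/2`. -/
lemma integral_cos_mul_cos {k : ℕ} (hk : 1 ≤ k) (l : ℕ) (c d : ℝ) :
    ∫ t in (-π)..π, cos (k * t + c) * cos (l * t + d) =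
      if k = l then π * cos (c - d) else 0 := by
  have h : ∀ t : ℝ, cos (k * t + c) * cos (l * t + d) =
      (1 / 2) * cos (((k - l : ℤ) : ℝ) * t + (c - d)) +
        (1 / 2) * cos (((k + l : ℤ) : ℝ) * t + (c + d)) := by
    intro t
    have h1 : ((k - l : ℤ) : ℝ) * t + (c - d) = (k * t + c) - (l * t + d) := by push_cast; ring
    have h2 : ((k + l : ℤ) : ℝ) * t + (c + d) = (k * t + c) + (l * t + d) := by push_cast; ring
    rw [h1, h2, cos_sub, cos_add (k * t + c)]
    ring
  simp_rw [h]
  rw [intervalIntegral.integral_add ((by fun_prop : Continuous _).intervalIntegrable _ _)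
    ((by fun_prop : Continuous _).intervalIntegrable _ _),
    intervalIntegral.integral_const_mul, intervalIntegral.integral_const_mul,
    integral_cos_int_mul_add, integral_cos_int_mul_add]
  have h3 : (k : ℤ) + l ≠ 0 := by omega
  rw [if_neg h3]
  by_cases hkl : k = l
  · subst hkl
    simp
    ring
  · have h4 : (k : ℤ) - l ≠ 0 := by omega
    simp [hkl, h4]

/-! ### Absolutely convergent trigonometric series -/

/-- The harmonic of order `k` with coefficients `a k`, `b k`. -/
noncomputable def harmonic (a b : ℕ → ℝ) (k : ℕ) (x : ℝ) : ℝ :=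
  a k * cos (k * x) + b k * sin (k * x)

/-- The trigonometric series `a₀ / 2 + ∑_{k ≥ 1} (a_k cos kx + b_k sin kx)`. -/
noncomputable def trigSeries (a b : ℕ → ℝ) (x : ℝ) : ℝ :=
  a 0 / 2 + ∑' k : ℕ, harmonic a b (k + 1) x

lemma abs_harmonic_le (a b : ℕ → ℝ) (k : ℕ) (x : ℝ) :
    |harmonic a b k x| ≤ |a k| + |b k| := by
  refine (abs_add_le _ _).trans (add_le_add ?_ ?_) <;> rw [abs_mul]
  · exact mul_le_of_le_one_right (abs_nonneg _) (abs_cos_le_one _)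
  · exact mul_le_of_le_one_right (abs_nonneg _) (abs_sin_le_one _)

@[fun_prop]
lemma continuous_harmonic (a b : ℕ → ℝ) (k : ℕ) : Continuous (harmonic a b k) := by
  unfold harmonic
  fun_prop

lemma summable_harmonic {a b : ℕ → ℝ} (h : Summable fun k : ℕ => |a (k + 1)| + |b (k + 1)|)
    (x : ℝ) : Summable fun k : ℕ => harmonic a b (k + 1) x :=
  Summable.of_norm_bounded h fun k => abs_harmonic_le a b (k + 1) x

lemma continuous_trigSeries {a b : ℕ → ℝ}
    (h : Summable fun k : ℕ => |a (k + 1)| + |b (k + 1)|) : Continuous (trigSeries a b) :=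
  continuous_const.add
    (continuous_tsum (fun k => continuous_harmonic a b (k + 1)) h
      fun k x => abs_harmonic_le a b (k + 1) x)

lemma abs_trigSeries_le {a b : ℕ → ℝ} (h : Summable fun k : ℕ => |a (k + 1)| + |b (k + 1)|)
    (x : ℝ) : |trigSeries a b x| ≤ |a 0 / 2| + ∑' k : ℕ, (|a (k + 1)| + |b (k + 1)|) :=
  (abs_add_le _ _).trans (add_le_add le_rfl
    (tsum_of_norm_bounded (f := fun k => harmonic a b (k + 1) x) h.hasSum
      fun k => abs_harmonic_le a b (k + 1) x))

lemma periodic_trigSeries (a b : ℕ → ℝ) : Function.Periodic (trigSeries a b) (2 * π) := by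
  intro x
  have h : ∀ k : ℕ, harmonic a b k (x + 2 * π) = harmonic a b k x := fun k => by
    rw [harmonic, mul_add, cos_add_nat_mul_two_pi, sin_add_nat_mul_two_pi, harmonic]
  simp only [trigSeries, h]

/-- Termwise integration of a dominated series of continuous functions against a weight. -/
lemma hasSum_integral_mul {u : ℕ → ℝ → ℝ} {c : ℕ → ℝ} {g : ℝ → ℝ} {p q : ℝ} (hc : Summable c)
    (hu : ∀ k, Continuous (u k)) (hb : ∀ k t, |u k t| ≤ c k)
    (hg : IntervalIntegrable g volume p q) :
    HasSum (fun k => ∫ t in p..q, u k t * g t)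
      (∫ t in p..q, (∑' k, u k t) * g t) := by
  refine intervalIntegral.hasSum_integral_of_dominated_convergence (fun k t => c k * |g t|)
    ?_ ?_ ?_ ?_ ?_
  · exact fun k => (hu k).aestronglyMeasurable.mul hg.def'.aestronglyMeasurable
  · refine fun k => Filter.Eventually.of_forall fun t _ => ?_
    rw [norm_mul]
    exact mul_le_mul_of_nonneg_right (hb k t) (abs_nonneg _)
  · exact Filter.Eventually.of_forall fun t _ => hc.mul_right _
  · simp_rw [tsum_mul_right]
    exact hg.abs.const_mul _
  · refine Filter.Eventually.of_forall fun t _ => ?_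
    have ht : Summable fun k => u k t := Summable.of_norm_bounded hc fun k => hb k t
    exact ht.hasSum.mul_right (g t)

lemma harmonic_eq_cos (a b : ℕ → ℝ) (k : ℕ) (x : ℝ) :
    harmonic a b k x = a k * cos (k * x + 0) + b k * cos (k * x + (-(π / 2))) := by
  rw [harmonic, ← sub_eq_add_neg, cos_sub_pi_div_two, add_zero]

lemma integral_harmonic_mul_cos (a b : ℕ → ℝ) {k : ℕ} (hk : 1 ≤ k) (j : ℕ) (d : ℝ) :
    ∫ t in (-π)..π, harmonic a b k t * cos (j * t + d) =
      if k = j then π * (a k * cos d - b k * sin d) else 0 := by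
  have h : ∀ t, harmonic a b k t * cos (j * t + d) =
      a k * (cos (k * t + 0) * cos (j * t + d)) +
        b k * (cos (k * t + (-(π / 2))) * cos (j * t + d)) := fun t => by
    rw [harmonic_eq_cos]; ring
  simp_rw [h]
  rw [intervalIntegral.integral_add ((by fun_prop : Continuous _).intervalIntegrable _ _)
    ((by fun_prop : Continuous _).intervalIntegrable _ _),
    intervalIntegral.integral_const_mul, intervalIntegral.integral_const_mul,
    integral_cos_mul_cos hk, integral_cos_mul_cos hk]
  split_ifs
  · rw [zero_sub, cos_neg, show -(π / 2) - d = -(d + π / 2) by ring, cos_neg, cos_add_pi_div_two]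
    ring
  · simp

lemma integral_trigSeries_mul_cos {a b : ℕ → ℝ}
    (h : Summable fun k : ℕ => |a (k + 1)| + |b (k + 1)|) (j : ℕ) (d : ℝ) :
    ∫ t in (-π)..π, trigSeries a b t * cos (j * t + d) =
      if j = 0 then π * (a 0 * cos d) else π * (a j * cos d - b j * sin d) := by
  have hg : IntervalIntegrable (fun t : ℝ => cos (j * t + d)) volume (-π) π :=
    (by fun_prop : Continuous _).intervalIntegrable _ _
  have hs := hasSum_integral_mul h (fun k => continuous_harmonic a b (k + 1))
    (fun k t => abs_harmonic_le a b (k + 1) t) hg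
  simp_rw [integral_harmonic_mul_cos a b (Nat.le_add_left 1 _)] at hs
  have hc : Continuous fun t => ∑' k : ℕ, harmonic a b (k + 1) t :=
    continuous_tsum (fun k => continuous_harmonic a b (k + 1)) h
      fun k x => abs_harmonic_le a b (k + 1) x
  simp only [trigSeries, add_mul]
  rw [intervalIntegral.integral_add ((by fun_prop : Continuous _).intervalIntegrable _ _)
    ((by fun_prop : Continuous _).intervalIntegrable _ _), ← hs.tsum_eq,
    intervalIntegral.integral_const_mul]
  have h0 := integral_cos_int_mul_add j d
  rw [Int.cast_natCast] at h0
  rw [h0]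
  rcases Nat.eq_zero_or_pos j with rfl | hj
  · simp
    ring
  · obtain ⟨i, rfl⟩ : ∃ i, j = i + 1 := ⟨j - 1, by omega⟩
    rw [tsum_eq_single i fun k hk => if_neg (by omega)]
    have h1 : ((i + 1 : ℕ) : ℤ) ≠ 0 := by omega
    rw [if_neg h1, if_pos rfl, if_neg (Nat.succ_ne_zero i), mul_zero, zero_add]

lemma cosCoeff_trigSeries {a b : ℕ → ℝ}
    (h : Summable fun k : ℕ => |a (k + 1)| + |b (k + 1)|) (j : ℕ) :
    cosCoeff (trigSeries a b) j = a j := by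
  have := integral_trigSeries_mul_cos h j 0
  simp only [add_zero] at this
  rw [cosCoeff, this]
  have := pi_pos
  split_ifs with hj
  · subst hj
    simp
  · simp

lemma sinCoeff_trigSeries {a b : ℕ → ℝ}
    (h : Summable fun k : ℕ => |a (k + 1)| + |b (k + 1)|) {j : ℕ} (hj : 1 ≤ j) :
    sinCoeff (trigSeries a b) j = b j := by
  have := integral_trigSeries_mul_cos h j (-(π / 2))
  simp only [← sub_eq_add_neg, cos_sub_pi_div_two] at this
  rw [sinCoeff, this, if_neg (by omega)]
  simp

/-- The remainder of a trigonometric series after its Fourier sum is its tail. -/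
lemma abs_trigSeries_sub_fourierSum_le {a b : ℕ → ℝ}
    (h : Summable fun k : ℕ => |a (k + 1)| + |b (k + 1)|) (m : ℕ) (x : ℝ) :
    |trigSeries a b x - fourierSum m (trigSeries a b) x| ≤
      ∑' k : ℕ, (|a (k + m + 1)| + |b (k + m + 1)|) := by
  have h1 : fourierSum m (trigSeries a b) x =
      a 0 / 2 + ∑ k ∈ Finset.range m, harmonic a b (k + 1) x := by
    rw [fourierSum, trigPoly, cosCoeff_trigSeries h, Finset.range_eq_Ico,
      Finset.sum_Ico_add' (fun k => harmonic a b k x) 0 m 1, zero_add, ← Finset.Ico_add_one_right_eq_Icc]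
    congr 1
    refine Finset.sum_congr rfl fun k hk => ?_
    rw [cosCoeff_trigSeries h, sinCoeff_trigSeries h (Finset.mem_Ico.1 hk).1, harmonic]
  rw [h1, trigSeries, add_sub_add_left_eq_sub,
    ← (summable_harmonic h x).sum_add_tsum_nat_add m, add_sub_cancel_left]
  exact tsum_of_norm_bounded (f := fun k => harmonic a b (k + m + 1) x)
    ((summable_nat_add_iff m).2 h).hasSum fun k => abs_harmonic_le a b (k + m + 1) x

/-! ### Uniqueness of Fourier coefficients -/

/-- Parseval's identity: all complex coefficients are combinations of the vanishing real ones, so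
the `L₂` norm is zero. -/
lemma ae_eq_zero_of_coeff_eq_zero {D : ℝ → ℝ} (hD : MemLp D 2 periodMeasure)
    (hc : ∀ k, cosCoeff D k = 0) (hs : ∀ k : ℕ, 1 ≤ k → sinCoeff D k = 0) :
    D =ᵐ[periodMeasure] 0 := by
  have hlt : -π < π := by linarith [pi_pos]
  have hL : MemLp (fun x => (D x : ℂ)) 2 (volume.restrict (Set.Ioc (-π) π)) := hD.ofReal
  have hfin : IsFiniteMeasure periodMeasure := by unfold periodMeasure; infer_instance
  have hDi : IntervalIntegrable D volume (-π) π := by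
    rw [intervalIntegrable_iff_integrableOn_Ioc_of_le hlt.le]
    exact hD.integrable (by norm_num)
  have hpi : (1 / π : ℝ) ≠ 0 := by positivity
  have hcos : ∀ k : ℕ, ∫ t in (-π)..π, D t * cos (k * t) = 0 := fun k =>
    (mul_eq_zero.1 (hc k)).resolve_left hpi
  have hsin : ∀ k : ℕ, ∫ t in (-π)..π, D t * sin (k * t) = 0 := fun k => by
    rcases Nat.eq_zero_or_pos k with rfl | hk
    · simp
    · exact (mul_eq_zero.1 (hs k hk)).resolve_left hpi
  have hcosZ : ∀ i : ℤ, ∫ t in (-π)..π, D t * cos (i * t) = 0 := fun i => by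
    rcases Int.natAbs_eq i with h | h <;> rw [h]
    · simpa using hcos i.natAbs
    · simpa using hcos i.natAbs
  have hsinZ : ∀ i : ℤ, ∫ t in (-π)..π, D t * sin (i * t) = 0 := fun i => by
    rcases Int.natAbs_eq i with h | h <;> rw [h]
    · simpa using hsin i.natAbs
    · simpa using hsin i.natAbs
  have hint : ∀ g : ℝ → ℝ, Continuous g →
      IntervalIntegrable (fun x => ((D x * g x : ℝ) : ℂ)) volume (-π) π := fun g hg =>
    have h := hDi.mul_continuousOn hg.continuousOn
    ⟨h.1.ofReal, h.2.ofReal⟩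
  have hcoef : ∀ i : ℤ, fourierCoeffOn hlt (fun x => (D x : ℂ)) i = 0 := fun i => by
    rw [fourierCoeffOn_eq_integral]
    have hpt : ∀ x : ℝ, fourier (-i) (x : AddCircle (π - -π)) • (D x : ℂ) =
        ((D x * cos (i * x) : ℝ) : ℂ) - ((D x * sin (i * x) : ℝ) : ℂ) * Complex.I := fun x => by
      rw [fourier_coe_apply]
      have : (2 * (π : ℂ) * Complex.I * ((-i : ℤ) : ℂ) * x / ((π - -π : ℝ) : ℂ)) =
          ((-(i * x) : ℝ) : ℂ) * Complex.I := by
        have : (π : ℂ) ≠ 0 := by exact_mod_cast pi_ne_zero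
        push_cast
        field_simp
        ring
      rw [this, Complex.exp_mul_I, ← Complex.ofReal_cos, ← Complex.ofReal_sin, cos_neg, sin_neg]
      push_cast
      simp only [smul_eq_mul]
      ring
    simp_rw [hpt]
    rw [intervalIntegral.integral_sub, intervalIntegral.integral_mul_const,
      intervalIntegral.integral_ofReal, intervalIntegral.integral_ofReal, hcosZ, hsinZ]
    · simp
    · exact hint _ (by fun_prop)
    · exact (hint _ (by fun_prop)).mul_const _
  have h := hasSum_sq_fourierCoeffOn hlt hL
  simp_rw [hcoef] at h
  have h0 := h.unique (a₂ := (0 : ℝ)) (by simp)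
  have hne : (π - -π)⁻¹ ≠ 0 := by
    have := pi_pos
    positivity
  have h1 : ∫ x in (-π)..π, ‖(D x : ℂ)‖ ^ 2 = 0 := by
    rw [smul_eq_mul] at h0
    exact (mul_eq_zero.1 h0).resolve_left hne
  rw [intervalIntegral.integral_of_le hlt.le,
    integral_eq_zero_iff_of_nonneg (fun x => by positivity)
      ((memLp_two_iff_integrable_sq_norm hL.1).1 hL)] at h1
  filter_upwards [h1] with x hx
  simpa using hx

/-- The set where `D` is nonzero is invariant under translation by periods and null in a fundamental
domain. The global statement is needed because `Ψ (x - t)` leaves the base period. -/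
lemma ae_of_ae_period {D : ℝ → ℝ} (hp : Function.Periodic D (2 * π))
    (hD : D =ᵐ[periodMeasure] 0) : D =ᵐ[volume] 0 := by
  have h2 : (0 : ℝ) < 2 * π := by positivity
  have hF := isAddFundamentalDomain_Ioc h2 (-π) volume
  rw [show -π + 2 * π = π by ring] at hF
  refine hF.measure_zero_of_invariant {x | ¬ D x = 0} ?_ ?_
  · rintro ⟨g, hg⟩
    obtain ⟨m, rfl⟩ := AddSubgroup.mem_zmultiples_iff.1 hg
    ext x
    rw [Set.mem_vadd_set_iff_neg_vadd_mem]
    have : D (-(m • (2 * π)) + x) = D x := by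
      have := hp.zsmul (-m) x
      rwa [neg_smul, add_comm] at this
    simpa [AddSubgroup.vadd_def] using not_congr (by rw [← zsmul_eq_mul, this])
  · have := hD
    rw [Filter.EventuallyEq, ae_iff, periodMeasure, Measure.restrict_apply₀'
      measurableSet_Ioc.nullMeasurableSet] at this
    exact this

/-! ### Tails of `∑ ψ(k)` -/

/-- Comparison with `∫ t ^ (-α)` over `[x, x + N]`, uniformly in `N`. -/
lemma sum_range_rpow_neg_le {α x : ℝ} (hα : 1 < α) (hx : 0 < x) (N : ℕ) :
    ∑ i ∈ Finset.range N, (x + ((i + 1 : ℕ) : ℝ)) ^ (-α) ≤ x ^ (1 - α) / (α - 1) := by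
  have hanti : AntitoneOn (fun t : ℝ => t ^ (-α)) (Set.Icc x (x + N)) := fun s hs t _ hst =>
    rpow_le_rpow_of_nonpos (hx.trans_le hs.1) hst (by linarith)
  refine hanti.sum_le_integral.trans ?_
  have h0 : (0 : ℝ) ∉ Set.uIcc x (x + N) := by
    rw [Set.uIcc_of_le (by simp)]
    exact fun h => hx.not_ge h.1
  rw [integral_rpow (Or.inr ⟨by linarith, h0⟩), show -α + 1 = -(α - 1) by ring, div_neg,
    ← neg_div, neg_sub, show -(α - 1) = 1 - α by ring]
  exact div_le_div_of_nonneg_right (sub_le_self _ (by positivity)) (by linarith)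

lemma exists_tail_bound {ψ : ℝ → ℝ} (hB : ψ ∈ setB) (hT : ψ ∈ Theta 1) :
    ∃ C : ℝ, 0 < C ∧ ∀ n : ℕ, 1 ≤ n → (Summable fun k : ℕ => ψ (k + n : ℕ)) ∧
      ∑' k : ℕ, ψ (k + n : ℕ) ≤ C * (ψ n * n) := by
  obtain ⟨hpos, -, -⟩ := hB
  obtain ⟨-, -, α, hα, K, hK, hdec⟩ := hT
  rw [div_one] at hα
  have hα' : 0 < α - 1 := by linarith
  -- The `1` pays for the term `k = n`, which the condition on `t₁ > t₂` does not reach; `K / (α -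
  -- 1)` pays for the terms `k > n`.
  refine ⟨1 + K / (α - 1), by positivity, fun n hn => ?_⟩
  have hn1 : (1 : ℝ) ≤ n := by exact_mod_cast hn
  have hn0 : (0 : ℝ) < n := by linarith
  have hψn : 0 < ψ n := hpos n hn1
  have hterm : ∀ i : ℕ, ψ (i + 1 + n : ℕ) ≤
      K * ((n : ℝ) ^ α * ψ n) * ((n : ℝ) + ((i + 1 : ℕ) : ℝ)) ^ (-α) := fun i => by
    have hlt : (n : ℝ) < (i + 1 + n : ℕ) := by exact_mod_cast (by omega)
    have h := hdec (i + 1 + n : ℕ) n hn1 hlt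
    have hp : (0 : ℝ) < (i + 1 + n : ℕ) := by linarith
    rw [show (n : ℝ) + ((i + 1 : ℕ) : ℝ) = (i + 1 + n : ℕ) by push_cast; ring, rpow_neg hp.le,
      ← div_eq_mul_inv, le_div_iff₀ (by positivity), mul_comm]
    exact h
  have hpart : ∀ N : ℕ, ∑ i ∈ Finset.range N, ψ (i + 1 + n : ℕ) ≤
      K / (α - 1) * (ψ n * n) := fun N => by
    refine (Finset.sum_le_sum fun i _ => hterm i).trans ?_
    rw [← Finset.mul_sum]
    refine (mul_le_mul_of_nonneg_left (sum_range_rpow_neg_le hα hn0 N) (by positivity)).trans_eq ?_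
    rw [rpow_sub hn0, rpow_one]
    have : (n : ℝ) ^ α ≠ 0 := by positivity
    field_simp
  have hnn : ∀ k : ℕ, 0 ≤ ψ (k + n : ℕ) := fun k =>
    (hpos _ (by exact_mod_cast (by omega))).le
  have hbound : ∀ N : ℕ, ∑ i ∈ Finset.range N, ψ (i + n : ℕ) ≤
      (1 + K / (α - 1)) * (ψ n * n) := fun N => by
    calc ∑ i ∈ Finset.range N, ψ (i + n : ℕ) ≤ ∑ i ∈ Finset.range (N + 1), ψ (i + n : ℕ) :=
          Finset.sum_le_sum_of_subset_of_nonneg (Finset.range_mono N.le_succ) fun i _ _ => hnn i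
      _ = ∑ i ∈ Finset.range N, ψ (i + 1 + n : ℕ) + ψ n := by
          rw [Finset.sum_range_succ', zero_add]
      _ ≤ K / (α - 1) * (ψ n * n) + ψ n * n :=
          add_le_add (hpart N) (le_mul_of_one_le_right hψn.le hn1)
      _ = _ := by ring
  have hs := summable_of_sum_range_le hnn hbound
  exact ⟨hs, hs.tsum_le_of_sum_range_le hbound⟩

/-! ### The kernel -/

/-- Cosine coefficients of the continuous kernel. -/
noncomputable def kernelCos (ψ : ℝ → ℝ) (β : ℝ) (k : ℕ) : ℝ :=
  if k = 0 then 0 else ψ k * cos (β * π / 2)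

/-- Sine coefficients of the continuous kernel. -/
noncomputable def kernelSin (ψ : ℝ → ℝ) (β : ℝ) (k : ℕ) : ℝ :=
  if k = 0 then 0 else ψ k * sin (β * π / 2)

/-- The continuous representative of `Ψ_β`. -/
noncomputable def kernel (ψ : ℝ → ℝ) (β : ℝ) : ℝ → ℝ :=
  trigSeries (kernelCos ψ β) (kernelSin ψ β)

lemma summable_abs_add_abs_of_le {ψ : ℝ → ℝ} (hs : Summable fun k : ℕ => ψ (k + 1 : ℕ))
    {a b : ℕ → ℝ} (ha : ∀ k, 1 ≤ k → |a k| ≤ ψ k) (hb : ∀ k, 1 ≤ k → |b k| ≤ ψ k) :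
    Summable fun k : ℕ => |a (k + 1)| + |b (k + 1)| :=
  Summable.of_nonneg_of_le (fun _ => by positivity)
    (fun k => add_le_add (ha (k + 1) (by omega)) (hb (k + 1) (by omega))) (hs.add hs)

section Kernel

variable {ψ : ℝ → ℝ} (hpos : ∀ k : ℕ, 1 ≤ k → 0 < ψ k)
  (hs : Summable fun k : ℕ => ψ (k + 1 : ℕ)) (β : ℝ)

include hpos in
lemma abs_kernelCos_le (k : ℕ) (hk : 1 ≤ k) : |kernelCos ψ β k| ≤ ψ k := by
  rw [kernelCos, if_neg (by omega), abs_mul, abs_of_pos (hpos k hk)]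
  exact mul_le_of_le_one_right (hpos k hk).le (abs_cos_le_one _)

include hpos in
lemma abs_kernelSin_le (k : ℕ) (hk : 1 ≤ k) : |kernelSin ψ β k| ≤ ψ k := by
  rw [kernelSin, if_neg (by omega), abs_mul, abs_of_pos (hpos k hk)]
  exact mul_le_of_le_one_right (hpos k hk).le (abs_sin_le_one _)

include hpos hs in
lemma summable_kernel :
    Summable fun k : ℕ => |kernelCos ψ β (k + 1)| + |kernelSin ψ β (k + 1)| :=
  summable_abs_add_abs_of_le hs (abs_kernelCos_le hpos β) (abs_kernelSin_le hpos β)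

include hpos hs in
lemma continuous_kernel : Continuous (kernel ψ β) :=
  continuous_trigSeries (summable_kernel hpos hs β)

include hpos hs in
lemma memLp_kernel (p : ℝ≥0∞) : MemLp (kernel ψ β) p periodMeasure := by
  have : IsFiniteMeasure periodMeasure := by unfold periodMeasure; infer_instance
  exact MemLp.of_bound (continuous_kernel hpos hs β).aestronglyMeasurable _
    (Filter.Eventually.of_forall fun x => abs_trigSeries_le (summable_kernel hpos hs β) x)

include hpos hs in
lemma isKernel_kernel : IsKernel ψ β (kernel ψ β) where
  periodic := periodic_trigSeries _ _
  integrable := memLp_one_iff_integrable.1 (memLp_kernel hpos hs β 1)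
  cosCoeff_zero := by
    rw [kernel, cosCoeff_trigSeries (summable_kernel hpos hs β), kernelCos, if_pos rfl]
  cosCoeff_eq k hk := by
    rw [kernel, cosCoeff_trigSeries (summable_kernel hpos hs β), kernelCos, if_neg (by omega)]
  sinCoeff_eq k hk := by
    rw [kernel, sinCoeff_trigSeries (summable_kernel hpos hs β) hk, kernelSin,
      if_neg (by omega)]

lemma intervalIntegrable_of_integrable {f : ℝ → ℝ} (hf : Integrable f periodMeasure) :
    IntervalIntegrable f volume (-π) π := by
  rwa [intervalIntegrable_iff_integrableOn_Ioc_of_le (by linarith [pi_pos])]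

include hpos hs in
-- The class allows any bounded representative of the kernel; both functions lie in `L₂` over a
-- period and share their coefficients, so the convolution may be computed with the continuous one.
lemma ae_eq_kernel {Ψ : ℝ → ℝ} (hΨ : IsKernel ψ β Ψ) (hL : MemLp Ψ ∞ periodMeasure) :
    Ψ =ᵐ[volume] kernel ψ β := by
  have : IsFiniteMeasure periodMeasure := by unfold periodMeasure; infer_instance
  have hk := isKernel_kernel hpos hs β
  have hi1 := intervalIntegrable_of_integrable hΨ.integrable
  have hi2 := intervalIntegrable_of_integrable hk.integrable
  have hcos : ∀ k, cosCoeff (Ψ - kernel ψ β) k = cosCoeff Ψ k - cosCoeff (kernel ψ β) k :=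
    fun k => by
      simp only [cosCoeff, Pi.sub_apply, sub_mul]
      rw [intervalIntegral.integral_sub (hi1.mul_continuousOn (by fun_prop))
        (hi2.mul_continuousOn (by fun_prop)), mul_sub]
  have hsin : ∀ k, sinCoeff (Ψ - kernel ψ β) k = sinCoeff Ψ k - sinCoeff (kernel ψ β) k :=
    fun k => by
      simp only [sinCoeff, Pi.sub_apply, sub_mul]
      rw [intervalIntegral.integral_sub (hi1.mul_continuousOn (by fun_prop))
        (hi2.mul_continuousOn (by fun_prop)), mul_sub]
  have h := ae_of_ae_period (D := Ψ - kernel ψ β)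
    (fun x => by simp only [Pi.sub_apply, hΨ.periodic x, hk.periodic x])
    (ae_eq_zero_of_coeff_eq_zero ((hL.mono_exponent le_top).sub (memLp_kernel hpos hs β 2))
      (fun k => by
        rcases Nat.eq_zero_or_pos k with rfl | hk'
        · rw [hcos, hΨ.cosCoeff_zero, hk.cosCoeff_zero, sub_zero]
        · rw [hcos, hΨ.cosCoeff_eq k hk', hk.cosCoeff_eq k hk', sub_self])
      (fun k hk' => by rw [hsin, hΨ.sinCoeff_eq k hk', hk.sinCoeff_eq k hk', sub_self]))
  filter_upwards [h] with x hx
  exact sub_eq_zero.1 hx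

lemma harmonic_kernel {k : ℕ} (hk : 1 ≤ k) (x : ℝ) :
    harmonic (kernelCos ψ β) (kernelSin ψ β) k x = ψ k * cos (k * x - β * π / 2) := by
  rw [harmonic, kernelCos, kernelSin, if_neg (by omega), if_neg (by omega), cos_sub]
  ring

/-- The factor `1/π` is simply bounded by `1`; only the order of magnitude matters. -/
lemma abs_integral_le_of_eLpNorm_le_one {φ w : ℝ → ℝ} (hφ : MemLp φ 1 periodMeasure)
    (hφ1 : eLpNorm φ 1 periodMeasure ≤ 1) (hw : ∀ t, |w t| ≤ 1) :
    |(1 / π) * ∫ t in (-π)..π, w t * φ t| ≤ 1 := by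
  have hle : -π ≤ π := by linarith [pi_pos]
  have hφi := memLp_one_iff_integrable.1 hφ
  have h1 : ∫ t in (-π)..π, |φ t| ≤ 1 := by
    rw [intervalIntegral.integral_of_le hle]
    have := integral_norm_eq_lintegral_enorm hφi.1
    rw [← eLpNorm_one_eq_lintegral_enorm] at this
    simp only [norm_eq_abs] at this
    refine this.trans_le ?_
    exact ENNReal.toReal_mono ENNReal.one_ne_top hφ1
  have h2 : |∫ t in (-π)..π, w t * φ t| ≤ ∫ t in (-π)..π, |φ t| := by
    rw [← norm_eq_abs]
    refine intervalIntegral.norm_integral_le_of_norm_le hle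
      (Filter.Eventually.of_forall fun t _ => ?_) (intervalIntegrable_of_integrable hφi).abs
    rw [norm_mul]
    exact mul_le_of_le_one_left (abs_nonneg _) (hw t)
  rw [abs_mul, abs_of_pos (by positivity)]
  have h3 : 1 / π ≤ 1 := by
    rw [div_le_one pi_pos]
    linarith [pi_gt_three]
  exact mul_le_one₀ h3 (abs_nonneg _) (h2.trans h1)

include hpos hs in
-- Convolve termwise and split `cos(kx - (kt + βπ/2))` by the subtraction formula: the integrals in
-- `t` become the coefficients.
lemma exists_trigSeries_of_mem_classC {f : ℝ → ℝ} (hf : f ∈ classC ψ β 1) :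
    ∃ a b : ℕ → ℝ, f = trigSeries a b ∧ (∀ k, 1 ≤ k → |a k| ≤ ψ k) ∧
      ∀ k, 1 ≤ k → |b k| ≤ ψ k := by
  obtain ⟨-, Ψ, φ, a₀, hΨ, hL, -, hφ, hφ1, -, hfx⟩ := hf
  have hconj : ENNReal.conjExponent 1 = ∞ := by simp [ENNReal.conjExponent]
  rw [hconj] at hL
  have hφi := intervalIntegrable_of_integrable (memLp_one_iff_integrable.1 hφ)
  let a : ℕ → ℝ := fun k =>
    if k = 0 then a₀ else ψ k * ((1 / π) * ∫ t in (-π)..π, cos (k * t + β * π / 2) * φ t)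
  let b : ℕ → ℝ := fun k =>
    ψ k * ((1 / π) * ∫ t in (-π)..π, sin (k * t + β * π / 2) * φ t)
  refine ⟨a, b, funext fun x => ?_, fun k hk => ?_, fun k hk => ?_⟩
  · have h1 : ∫ t in (-π)..π, Ψ (x - t) * φ t =
        ∫ t in (-π)..π, (∑' k : ℕ, harmonic (kernelCos ψ β) (kernelSin ψ β) (k + 1) (x - t)) *
          φ t := by
      refine intervalIntegral.integral_congr_ae ?_
      -- The reflection `t ↦ x - t` pulls null sets back to null sets, so the a.e. identity survives
      -- the substitution.
      have h := (quasiMeasurePreserving_sub_left_of_right_invariant volume x).ae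
        (ae_eq_kernel hpos hs β hΨ hL)
      filter_upwards [h] with t ht _
      rw [ht, kernel, trigSeries, kernelCos, if_pos rfl, zero_div, zero_add]
    have h2 := hasSum_integral_mul (summable_kernel hpos hs β)
      (u := fun k t => harmonic (kernelCos ψ β) (kernelSin ψ β) (k + 1) (x - t))
      (fun k => by fun_prop) (fun k t => abs_harmonic_le _ _ (k + 1) (x - t)) hφi
    rw [hfx, h1, ← h2.tsum_eq, ← tsum_mul_left, trigSeries]
    have ha0 : a 0 = a₀ := if_pos rfl
    rw [ha0]
    congr 2
    funext k
    have hpt : ∀ t, harmonic (kernelCos ψ β) (kernelSin ψ β) (k + 1) (x - t) * φ t =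
        (ψ (k + 1 : ℕ) * cos ((k + 1 : ℕ) * x)) * (cos ((k + 1 : ℕ) * t + β * π / 2) * φ t) +
        (ψ (k + 1 : ℕ) * sin ((k + 1 : ℕ) * x)) * (sin ((k + 1 : ℕ) * t + β * π / 2) * φ t) := by
      intro t
      rw [harmonic_kernel β (Nat.le_add_left 1 k),
        show ((k + 1 : ℕ) : ℝ) * (x - t) - β * π / 2 =
          (k + 1 : ℕ) * x - ((k + 1 : ℕ) * t + β * π / 2) by ring, cos_sub]
      ring
    have hak : a (k + 1) = ψ (k + 1 : ℕ) *
      ((1 / π) * ∫ t in (-π)..π, cos ((k + 1 : ℕ) * t + β * π / 2) * φ t) :=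
      if_neg (Nat.succ_ne_zero k)
    simp_rw [hpt]
    rw [intervalIntegral.integral_add, intervalIntegral.integral_const_mul,
      intervalIntegral.integral_const_mul, harmonic, hak]
    · ring
    · exact (hφi.continuousOn_mul (by fun_prop)).const_mul _
    · exact (hφi.continuousOn_mul (by fun_prop)).const_mul _
  · have hak : a k = ψ k * ((1 / π) * ∫ t in (-π)..π, cos (k * t + β * π / 2) * φ t) :=
      if_neg (by omega)
    rw [hak, abs_mul, abs_of_pos (hpos k hk)]
    exact mul_le_of_le_one_right (hpos k hk).le
      (abs_integral_le_of_eLpNorm_le_one hφ hφ1 fun t => abs_cos_le_one _)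
  · rw [abs_mul, abs_of_pos (hpos k hk)]
    exact mul_le_of_le_one_right (hpos k hk).le
      (abs_integral_le_of_eLpNorm_le_one hφ hφ1 fun t => abs_sin_le_one _)

end Kernel

/-! ### Upper bound -/

lemma fourierApprox_le {ψ : ℝ → ℝ} (hpos : ∀ k : ℕ, 1 ≤ k → 0 < ψ k)
    (hs : Summable fun k : ℕ => ψ (k + 1 : ℕ)) (β : ℝ) {n : ℕ} (hn : 1 ≤ n) :
    fourierApprox n (classC ψ β 1) ≤ ENNReal.ofReal (2 * ∑' k : ℕ, ψ (k + n : ℕ)) := by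
  refine iSup₂_le fun f hf => iSup_le fun x => ?_
  obtain ⟨a, b, rfl, ha, hb⟩ := exists_trigSeries_of_mem_classC hpos hs β hf
  have hab := summable_abs_add_abs_of_le hs ha hb
  rw [← ofReal_norm]
  refine ENNReal.ofReal_le_ofReal ((abs_trigSeries_sub_fourierSum_le hab (n - 1) x).trans ?_)
  obtain ⟨m, rfl⟩ : ∃ m, n = m + 1 := ⟨n - 1, by omega⟩
  have hs' : Summable fun k : ℕ => ψ (k + (m + 1) : ℕ) := (summable_nat_add_iff m).2 hs
  rw [← tsum_mul_left]
  refine Summable.tsum_le_tsum (fun k => ?_) ((summable_nat_add_iff m).2 hab) (hs'.mul_left 2)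
  rw [two_mul]
  exact add_le_add (ha (k + m + 1) (by omega)) (hb (k + m + 1) (by omega))

lemma bestApprox_le_fourierApprox (n : ℕ) (N : Set (ℝ → ℝ)) :
    bestApprox n N ≤ fourierApprox n N :=
  iSup₂_mono fun f _ => iInf₂_le (fourierSum (n - 1) f) ⟨_, _, rfl⟩

/-! ### Modulated Fejér kernels -/

/-- `n` times the Fejér kernel of order `n`. -/
noncomputable def fejerSq (n : ℕ) (x : ℝ) : ℝ :=
  (∑ j ∈ Finset.range n, cos (j * x)) ^ 2 + (∑ j ∈ Finset.range n, sin (j * x)) ^ 2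

/-- The frequency `2n + i - j` attached to a pair `(i, j)`. -/
def freq (n : ℕ) (p : ℕ × ℕ) : ℕ := 2 * n + p.1 - p.2

/-- The pairs of indices below `n`. -/
def pairs (n : ℕ) : Finset (ℕ × ℕ) := Finset.range n ×ˢ Finset.range n

/-- The Fejér kernel shifted to frequencies around `2n`, with phase `d`. -/
noncomputable def shiftedFejer (n : ℕ) (d x : ℝ) : ℝ :=
  ∑ p ∈ pairs n, cos (freq n p * x + d)

/-- This gives orthogonality to polynomials of order `n - 1` and mean zero; the upper bound `3 * n`
keeps `ψ` comparable to `ψ n`. -/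
lemma lt_freq {n : ℕ} {p : ℕ × ℕ} (hp : p ∈ pairs n) : n < freq n p := by
  simp only [pairs, Finset.mem_product, Finset.mem_range] at hp
  unfold freq
  omega

lemma freq_lt {n : ℕ} {p : ℕ × ℕ} (hp : p ∈ pairs n) : freq n p < 3 * n := by
  simp only [pairs, Finset.mem_product, Finset.mem_range] at hp
  unfold freq
  omega

lemma cast_freq {n : ℕ} {p : ℕ × ℕ} (hp : p ∈ pairs n) :
    (freq n p : ℝ) = 2 * n + p.1 - p.2 := by
  simp only [pairs, Finset.mem_product, Finset.mem_range] at hp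
  rw [freq, Nat.cast_sub (by omega)]
  push_cast
  ring

lemma fejerSq_eq_sum (n : ℕ) (x : ℝ) :
    fejerSq n x = ∑ p ∈ pairs n, cos (((p.1 - p.2 : ℤ) : ℝ) * x + 0) := by
  have h : ∀ p : ℕ × ℕ, cos (((p.1 - p.2 : ℤ) : ℝ) * x + 0) =
      cos (p.1 * x) * cos (p.2 * x) + sin (p.1 * x) * sin (p.2 * x) := fun p => by
    rw [← cos_sub]
    congr 1
    push_cast
    ring
  simp_rw [h]
  rw [Finset.sum_add_distrib, fejerSq, sq, sq, Finset.sum_mul_sum, Finset.sum_mul_sum,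
    pairs, Finset.sum_product, Finset.sum_product]

/-- By the addition formula the remaining part carries `sin((i - j)x)`, which is antisymmetric in
`(i, j)` and sums to zero. Hence the modulated kernel is dominated by the nonnegative `fejerSq`. -/
lemma shiftedFejer_eq (n : ℕ) (d x : ℝ) :
    shiftedFejer n d x = cos (2 * n * x + d) * fejerSq n x := by
  have h : ∀ p ∈ pairs n, cos (freq n p * x + d) =
      cos (2 * n * x + d) * cos (((p.1 - p.2 : ℤ) : ℝ) * x + 0) -
        sin (2 * n * x + d) * (sin (p.1 * x) * cos (p.2 * x) - cos (p.1 * x) * sin (p.2 * x)) :=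
    fun p hp => by
      rw [← sin_sub, ← sub_mul, cast_freq hp,
        show (2 * n + p.1 - p.2 : ℝ) * x + d = (2 * n * x + d) + ((p.1 : ℝ) - p.2) * x by ring,
        cos_add]
      push_cast
      rw [add_zero]
  rw [shiftedFejer, Finset.sum_congr rfl h, Finset.sum_sub_distrib, ← Finset.mul_sum,
    ← Finset.mul_sum, ← fejerSq_eq_sum, Finset.sum_sub_distrib]
  have h1 : ∑ p ∈ pairs n, sin (p.1 * x) * cos (p.2 * x) =
      ∑ p ∈ pairs n, cos (p.1 * x) * sin (p.2 * x) := by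
    rw [pairs, Finset.sum_product, Finset.sum_product]
    simp only
    rw [← Finset.sum_mul_sum, ← Finset.sum_mul_sum, mul_comm]
  rw [h1, sub_self, mul_zero, sub_zero]

@[fun_prop]
lemma continuous_shiftedFejer (n : ℕ) (d : ℝ) : Continuous (shiftedFejer n d) := by
  unfold shiftedFejer
  fun_prop

lemma fejerSq_nonneg (n : ℕ) (x : ℝ) : 0 ≤ fejerSq n x := by
  unfold fejerSq
  positivity

/-- Only the `n` diagonal pairs have frequency zero. -/
lemma integral_fejerSq (n : ℕ) : ∫ x in (-π)..π, fejerSq n x = 2 * π * n := by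
  simp_rw [fejerSq_eq_sum]
  rw [intervalIntegral.integral_finsetSum fun p _ =>
    (by fun_prop : Continuous _).intervalIntegrable _ _]
  simp_rw [integral_cos_int_mul_add]
  rw [pairs, Finset.sum_product]
  simp only [sub_eq_zero, Nat.cast_inj, Finset.sum_ite_eq, cos_zero, mul_one]
  rw [Finset.sum_congr rfl fun i hi => if_pos hi]
  simp [mul_comm]

lemma integral_abs_shiftedFejer_le (n : ℕ) (d : ℝ) :
    ∫ x in (-π)..π, |shiftedFejer n d x| ≤ 2 * π * n := by
  have hc : Continuous (fejerSq n) := by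
    unfold fejerSq
    fun_prop
  rw [← integral_fejerSq]
  refine intervalIntegral.integral_mono_on (by linarith [pi_pos])
    ((by fun_prop : Continuous _).intervalIntegrable _ _) (hc.intervalIntegrable _ _)
    fun x _ => ?_
  rw [shiftedFejer_eq, abs_mul, abs_of_nonneg (fejerSq_nonneg n x)]
  exact mul_le_of_le_one_left (fejerSq_nonneg n x) (abs_cos_le_one _)

lemma integral_mul_shiftedFejer {F : ℝ → ℝ} (hF : Continuous F) (n : ℕ) (d : ℝ) :
    ∫ x in (-π)..π, F x * shiftedFejer n d x =
      ∑ p ∈ pairs n, ∫ x in (-π)..π, F x * cos (freq n p * x + d) := by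
  simp_rw [shiftedFejer, Finset.mul_sum]
  exact intervalIntegral.integral_finsetSum fun p _ =>
    (by fun_prop : Continuous _).intervalIntegrable _ _

lemma integral_trigPoly_mul_cos (m : ℕ) (a b : ℕ → ℝ) {j : ℕ} (hj : m < j) (d : ℝ) :
    ∫ x in (-π)..π, trigPoly m a b x * cos (j * x + d) = 0 := by
  have h : ∀ x : ℝ, trigPoly m a b x * cos (j * x + d) =
      a 0 / 2 * cos ((j : ℤ) * x + d) +
        ∑ k ∈ Finset.Icc 1 m, harmonic a b k x * cos (j * x + d) := fun x => by
    rw [trigPoly, add_mul, Finset.sum_mul]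
    rfl
  have hj0 : (j : ℤ) ≠ 0 := by omega
  simp_rw [h]
  rw [intervalIntegral.integral_add ((by fun_prop : Continuous _).intervalIntegrable _ _)
    ((by fun_prop : Continuous _).intervalIntegrable _ _),
    intervalIntegral.integral_const_mul, integral_cos_int_mul_add, if_neg hj0, mul_zero, zero_add,
    intervalIntegral.integral_finsetSum fun k _ =>
      (by fun_prop : Continuous _).intervalIntegrable _ _]
  refine Finset.sum_eq_zero fun k hk => ?_
  rw [Finset.mem_Icc] at hk
  rw [integral_harmonic_mul_cos a b hk.1, if_neg (by omega)]

lemma integral_trigPoly_mul_shiftedFejer {n : ℕ} (hn : 1 ≤ n) (a b : ℕ → ℝ) (d : ℝ) :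
    ∫ x in (-π)..π, trigPoly (n - 1) a b x * shiftedFejer n d x = 0 := by
  have hc : Continuous (trigPoly (n - 1) a b) := by
    unfold trigPoly
    fun_prop
  rw [integral_mul_shiftedFejer hc]
  exact Finset.sum_eq_zero fun p hp =>
    integral_trigPoly_mul_cos _ a b (by have := lt_freq hp; omega) d

/-- The number of coincidences among the frequencies is at least `n ^ 3 / 2`. -/
lemma cube_le_card_freq_eq (n : ℕ) :
    n ^ 3 ≤ 2 * ((pairs n ×ˢ pairs n).filter fun x => freq n x.1 = freq n x.2).card := by
  rcases Nat.eq_zero_or_pos n with rfl | hn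
  · simp
  -- Cauchy–Schwarz for additive energy, `|A|²|A|² ≤ |A + A| E(A, A)`, with `|A + A| ≤ 2n`.
  have hE := Finset.le_card_add_mul_addEnergy (Finset.range n) (Finset.range n)
  have hsub : Finset.range n + Finset.range n ⊆ Finset.range (2 * n) := fun k hk => by
    obtain ⟨i, hi, j, hj, rfl⟩ := Finset.mem_add.1 hk
    rw [Finset.mem_range] at *
    omega
  have hcard := Finset.card_le_card hsub
  rw [Finset.card_range] at hcard
  have hEq : Finset.addEnergy (Finset.range n) (Finset.range n) =
      ((pairs n ×ˢ pairs n).filter fun x => freq n x.1 = freq n x.2).card := by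
    -- The energy counts `a₁ + b₁ = a₂ + b₂`; rewriting this as `a₁ - b₂ = a₂ - b₁` turns it into
    -- equality of frequencies.
    refine Finset.card_nbij' (fun x => ((x.1.1, x.2.2), (x.1.2, x.2.1)))
      (fun x => ((x.1.1, x.2.1), (x.2.2, x.1.2))) ?_ ?_ (fun _ _ => rfl) (fun _ _ => rfl)
    · rintro ⟨⟨a, b⟩, c, d⟩ h
      simp only [Finset.mem_coe, Finset.mem_filter, Finset.mem_product] at h ⊢
      simp only [pairs, freq, Finset.mem_product, Finset.mem_range] at h ⊢
      omega
    · rintro ⟨⟨a, b⟩, c, d⟩ h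
      simp only [Finset.mem_coe, Finset.mem_filter, Finset.mem_product] at h ⊢
      simp only [pairs, freq, Finset.mem_product, Finset.mem_range] at h ⊢
      omega
  rw [hEq, Finset.card_range] at hE
  have h := hE.trans (Nat.mul_le_mul_right _ hcard)
  refine le_of_mul_le_mul_left (a := n) ?_ hn
  calc n * n ^ 3 = n ^ 2 * n ^ 2 := by ring
    _ ≤ _ := h
    _ = _ := by ring

/-! ### Lower bound -/

/-- The convolution of the kernel with the normalized shifted Fejér kernel. -/
noncomputable def extremal (ψ : ℝ → ℝ) (β : ℝ) (n : ℕ) (x : ℝ) : ℝ :=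
  (2 * π * n)⁻¹ * ∑ p ∈ pairs n, ψ (freq n p) * cos (freq n p * x + -(β * π / 2))

@[fun_prop]
lemma continuous_extremal (ψ : ℝ → ℝ) (β : ℝ) (n : ℕ) : Continuous (extremal ψ β n) := by
  unfold extremal
  fun_prop

lemma integral_kernel_sub_mul_cos {ψ : ℝ → ℝ} (hpos : ∀ k : ℕ, 1 ≤ k → 0 < ψ k)
    (hs : Summable fun k : ℕ => ψ (k + 1 : ℕ)) (β : ℝ) {m : ℕ} (hm : 1 ≤ m) (x : ℝ) :
    ∫ t in (-π)..π, kernel ψ β (x - t) * cos (m * t + 0) =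
      π * (ψ m * cos (m * x + -(β * π / 2))) := by
  have hF : Function.Periodic (fun s => kernel ψ β s * cos (m * s + -(m * x))) (2 * π) := by
    intro s
    have h1 : (m : ℝ) * (s + 2 * π) + -(m * x) = m * s + -(m * x) + m * (2 * π) := by ring
    simp only
    rw [(isKernel_kernel hpos hs β).periodic s, h1, cos_add_nat_mul_two_pi]
  have hpt : ∀ t, kernel ψ β (x - t) * cos (m * t + 0) =
      (fun s => kernel ψ β s * cos (m * s + -(m * x))) (x - t) := fun t => by
    simp only
    rw [show (m : ℝ) * (x - t) + -(m * x) = -(m * t + 0) by ring, cos_neg]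
  simp_rw [hpt]
  -- After `s = x - t`, periodicity moves the window back to `[-π, π]`, where the coefficient
  -- formula applies.
  rw [intervalIntegral.integral_comp_sub_left (fun s => kernel ψ β s * cos (m * s + -(m * x))),
    show x - -π = x - π + 2 * π by ring, hF.intervalIntegral_add_eq (x - π) (-π),
    show -π + 2 * π = π by ring, kernel, integral_trigSeries_mul_cos (summable_kernel hpos hs β),
    if_neg (by omega), cos_neg, sin_neg, ← sub_eq_add_neg, ← harmonic_kernel β hm, harmonic]
  ring

lemma extremal_mem_classC {ψ : ℝ → ℝ} (hpos : ∀ k : ℕ, 1 ≤ k → 0 < ψ k)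
    (hs : Summable fun k : ℕ => ψ (k + 1 : ℕ)) (β : ℝ) {n : ℕ} (hn : 1 ≤ n) :
    extremal ψ β n ∈ classC ψ β 1 := by
  have hle : -π ≤ π := by linarith [pi_pos]
  have hn0 : (0 : ℝ) < n := by exact_mod_cast hn
  let φ : ℝ → ℝ := fun t => (2 * π * n)⁻¹ * shiftedFejer n 0 t
  have hφc : Continuous φ := by fun_prop
  have hφi : Integrable φ periodMeasure := by
    have := hφc.intervalIntegrable (μ := volume) (-π) π
    rwa [intervalIntegrable_iff_integrableOn_Ioc_of_le hle] at this
  refine ⟨continuous_extremal ψ β n, kernel ψ β, φ, 0, isKernel_kernel hpos hs β,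
    memLp_kernel hpos hs β _, ?_, memLp_one_iff_integrable.2 hφi, ?_, ?_, fun x => ?_⟩
  · intro t
    simp only [φ, shiftedFejer]
    congr 1
    refine Finset.sum_congr rfl fun p _ => ?_
    rw [show (freq n p : ℝ) * (t + 2 * π) + 0 = freq n p * t + 0 + freq n p * (2 * π) by ring,
      cos_add_nat_mul_two_pi]
  · rw [eLpNorm_one_eq_lintegral_enorm, ← ofReal_integral_norm_eq_lintegral_enorm hφi]
    refine ENNReal.ofReal_le_one.2 ?_
    have h1 : ∫ t, ‖φ t‖ ∂periodMeasure = ∫ t in (-π)..π, |φ t| := by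
      rw [intervalIntegral.integral_of_le hle]
      rfl
    have h2 : ∀ t, |φ t| = (2 * π * n)⁻¹ * |shiftedFejer n 0 t| := fun t => by
      rw [abs_mul, abs_of_pos (by positivity)]
    simp_rw [h1, h2]
    rw [intervalIntegral.integral_const_mul, inv_mul_le_one₀ (by positivity)]
    exact integral_abs_shiftedFejer_le n 0
  · have h2 := integral_mul_shiftedFejer (F := fun _ => 1) continuous_const n 0
    simp only [φ]
    rw [intervalIntegral.integral_const_mul]
    simp only [one_mul] at h2
    rw [h2, Finset.sum_eq_zero fun p hp => ?_, mul_zero]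
    have h3 := integral_cos_int_mul_add (freq n p) 0
    rw [Int.cast_natCast, if_neg (by have := lt_freq hp; omega)] at h3
    exact h3
  · have hk := continuous_kernel hpos hs β
    have hc : Continuous fun t => kernel ψ β (x - t) := by fun_prop
    have h1 : ∫ t in (-π)..π, kernel ψ β (x - t) * φ t = (2 * π * n)⁻¹ *
        ∫ t in (-π)..π, kernel ψ β (x - t) * shiftedFejer n 0 t := by
      rw [← intervalIntegral.integral_const_mul]
      refine intervalIntegral.integral_congr fun t _ => ?_
      simp only [φ]
      ring
    rw [h1, integral_mul_shiftedFejer hc, Finset.sum_congr rfl fun p hp =>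
      integral_kernel_sub_mul_cos hpos hs β (by have := lt_freq hp; omega) x, ← Finset.mul_sum,
      extremal]
    have hpi := pi_ne_zero
    rw [zero_div, zero_add, mul_left_comm, ← mul_assoc (1 / π), one_div, inv_mul_cancel₀ hpi,
      one_mul]

/-- With equal phases, each coincidence contributes `π ψ / (2πn) ≥ c / (2n)`, and there are at least
`n³/2` of them. -/
lemma le_integral_extremal_mul_shiftedFejer {ψ : ℝ → ℝ} {n : ℕ} (hn : 1 ≤ n) {c : ℝ} (hc : 0 ≤ c)
    (hψ : ∀ k : ℕ, n ≤ k → k ≤ 3 * n → c ≤ ψ k) (β : ℝ) :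
    c * n ^ 2 / 4 ≤
      ∫ x in (-π)..π, extremal ψ β n x * shiftedFejer n (-(β * π / 2)) x := by
  have hn0 : (0 : ℝ) < n := by exact_mod_cast hn
  have hterm : ∀ q ∈ pairs n,
      ∫ x in (-π)..π, extremal ψ β n x * cos (freq n q * x + -(β * π / 2)) =
        (2 * n : ℝ)⁻¹ * ∑ p ∈ pairs n, if freq n p = freq n q then ψ (freq n p) else 0 :=
    fun q _ => by
      have hpt : ∀ x, extremal ψ β n x * cos (freq n q * x + -(β * π / 2)) =
          (2 * π * n)⁻¹ * ∑ p ∈ pairs n, ψ (freq n p) *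
            (cos (freq n p * x + -(β * π / 2)) * cos (freq n q * x + -(β * π / 2))) := fun x => by
        rw [extremal, mul_assoc, Finset.sum_mul]
        simp_rw [mul_assoc]
      simp_rw [hpt]
      rw [intervalIntegral.integral_const_mul, intervalIntegral.integral_finsetSum fun p _ =>
        (by fun_prop : Continuous _).intervalIntegrable _ _]
      simp_rw [intervalIntegral.integral_const_mul]
      rw [Finset.sum_congr rfl fun p hp => by
        rw [integral_cos_mul_cos (by have := lt_freq hp; omega : 1 ≤ freq n p)]]
      simp only [sub_self, cos_zero, mul_one, mul_ite, mul_zero]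
      have hpi := pi_pos
      rw [mul_inv, mul_inv, mul_inv, Finset.mul_sum, Finset.mul_sum]
      refine Finset.sum_congr rfl fun p _ => ?_
      split_ifs
      · field_simp
      · simp
  rw [integral_mul_shiftedFejer (continuous_extremal ψ β n), Finset.sum_congr rfl hterm,
    ← Finset.mul_sum, Finset.sum_comm, ← Finset.sum_product', ← Finset.sum_filter]
  have hlow : (((pairs n ×ˢ pairs n).filter fun x => freq n x.1 = freq n x.2).card : ℝ) * c ≤
      ∑ x ∈ (pairs n ×ˢ pairs n).filter (fun x => freq n x.1 = freq n x.2), ψ (freq n x.1) := by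
    rw [← nsmul_eq_mul]
    refine Finset.card_nsmul_le_sum _ _ _ fun x hx => ?_
    have hx1 := (Finset.mem_product.1 (Finset.mem_filter.1 hx).1).1
    exact hψ _ (lt_freq hx1).le (freq_lt hx1).le
  have hcard : (n : ℝ) ^ 3 ≤
      2 * (((pairs n ×ˢ pairs n).filter fun x => freq n x.1 = freq n x.2).card : ℝ) := by
    exact_mod_cast cube_le_card_freq_eq n
  rw [inv_mul_eq_div, le_div_iff₀ (by positivity)]
  calc c * n ^ 2 / 4 * (2 * n) = (n ^ 3 / 2) * c := by ring
    _ ≤ _ := mul_le_mul_of_nonneg_right (by linarith) hc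
    _ ≤ _ := hlow

/-- Duality: with `M` the uniform error, `c n²/4 ≤ ∫ (f - T) g ≤ M ∫|g| ≤ 2πn M`, whence `M ≥ c n /
(8π)`. -/
lemma ofReal_le_bestApprox {ψ : ℝ → ℝ} (hpos : ∀ k : ℕ, 1 ≤ k → 0 < ψ k)
    (hs : Summable fun k : ℕ => ψ (k + 1 : ℕ)) (β : ℝ) {n : ℕ} (hn : 1 ≤ n) {c : ℝ} (hc : 0 ≤ c)
    (hψ : ∀ k : ℕ, n ≤ k → k ≤ 3 * n → c ≤ ψ k) :
    ENNReal.ofReal (c * n / (8 * π)) ≤ bestApprox n (classC ψ β 1) := by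
  rw [bestApprox]
  refine le_iSup₂_of_le (extremal ψ β n) (extremal_mem_classC hpos hs β hn)
    (le_iInf₂ fun T hT => ?_)
  obtain ⟨a, b, rfl⟩ := hT
  -- The infinite value is set aside because `toReal` would send it to `0`.
  by_cases htop : normC (fun x => extremal ψ β n x - trigPoly (n - 1) a b x) = ∞
  · rw [htop]
    exact le_top
  refine ENNReal.ofReal_le_of_le_toReal ?_
  set M := (normC (fun x => extremal ψ β n x - trigPoly (n - 1) a b x)).toReal with hM
  have hbd : ∀ x, |extremal ψ β n x - trigPoly (n - 1) a b x| ≤ M := fun x => by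
    have h := ENNReal.toReal_mono htop
      (le_iSup (fun x => ‖extremal ψ β n x - trigPoly (n - 1) a b x‖ₑ) x)
    rwa [toReal_enorm] at h
  have hM0 : 0 ≤ M := ENNReal.toReal_nonneg
  set g := shiftedFejer n (-(β * π / 2)) with hg
  have hgc : Continuous g := continuous_shiftedFejer _ _
  have hTc : Continuous (trigPoly (n - 1) a b) := by
    unfold trigPoly
    fun_prop
  have h1 : ∫ x in (-π)..π, (extremal ψ β n x - trigPoly (n - 1) a b x) * g x =
      ∫ x in (-π)..π, extremal ψ β n x * g x := by
    simp_rw [sub_mul]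
    rw [intervalIntegral.integral_sub ((by fun_prop : Continuous _).intervalIntegrable _ _)
      ((by fun_prop : Continuous _).intervalIntegrable _ _),
      integral_trigPoly_mul_shiftedFejer hn, sub_zero]
  have h2 : ∫ x in (-π)..π, (extremal ψ β n x - trigPoly (n - 1) a b x) * g x ≤
      ∫ x in (-π)..π, M * |g x| := by
    refine intervalIntegral.integral_mono_on (by linarith [pi_pos])
      ((by fun_prop : Continuous _).intervalIntegrable _ _)
      ((by fun_prop : Continuous _).intervalIntegrable _ _) fun x _ => ?_
    refine (le_abs_self _).trans ?_
    rw [abs_mul]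
    exact mul_le_mul_of_nonneg_right (hbd x) (abs_nonneg _)
  have h3 := le_integral_extremal_mul_shiftedFejer hn hc hψ β
  rw [intervalIntegral.integral_const_mul] at h2
  have h4 := mul_le_mul_of_nonneg_left (integral_abs_shiftedFejer_le n (-(β * π / 2))) hM0
  have hn0 : (0 : ℝ) < n := by exact_mod_cast hn
  have h5 : c * n ^ 2 / 4 ≤ M * (2 * π * n) := by linarith
  rw [div_le_iff₀ (by positivity)]
  refine le_of_mul_le_mul_right ?_ hn0
  linarith

/-! ### Doubling condition and conclusion -/

/-- Two doublings reach `4t`, enough to cover the frequencies up to `3n`. -/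
lemma le_sq_mul_of_mem_setB {ψ : ℝ → ℝ} {K : ℝ} (hK : 0 < K) (hpos : ∀ t : ℝ, 1 ≤ t → 0 < ψ t)
    (hdec : AntitoneOn ψ (Set.Ici 1)) (hdbl : ∀ t : ℝ, 1 ≤ t → ψ t / ψ (2 * t) ≤ K)
    {s t : ℝ} (ht : 1 ≤ t) (hts : t ≤ s) (hs : s ≤ 4 * t) : ψ t ≤ K ^ 2 * ψ s := by
  have h1 := (div_le_iff₀ (hpos (2 * t) (by linarith))).1 (hdbl t ht)
  have h2 := (div_le_iff₀ (hpos (2 * (2 * t)) (by linarith))).1 (hdbl (2 * t) (by linarith))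
  have h3 : ψ (2 * (2 * t)) ≤ ψ s :=
    hdec (Set.mem_Ici.2 (ht.trans hts)) (Set.mem_Ici.2 (by linarith)) (by linarith)
  calc ψ t ≤ K * ψ (2 * t) := h1
    _ ≤ K * (K * ψ s) := by gcongr; exact h2.trans (by gcongr)
    _ = K ^ 2 * ψ s := by ring

end PsiBeta

theorem mainTheorem2 (ψ : ℝ → ℝ) (hψ : ψ ∈ PsiBeta.setB ∩ PsiBeta.Theta 1)
    (hΔ : (∀ k : ℕ, 1 ≤ k → 0 ≤ PsiBeta.secondDiffInv ψ k) ∨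
      (∀ k : ℕ, 1 ≤ k → PsiBeta.secondDiffInv ψ k ≤ 0)) :
    ∃ K₁ K₂ : ℝ, 0 < K₁ ∧ 0 < K₂ ∧ ∀ (β : ℝ) (n : ℕ), 1 ≤ n →
      ENNReal.ofReal (K₂ * ψ n * n) ≤ PsiBeta.bestApprox n (PsiBeta.classC ψ β 1) ∧
      PsiBeta.bestApprox n (PsiBeta.classC ψ β 1) ≤
        PsiBeta.fourierApprox n (PsiBeta.classC ψ β 1) ∧
      PsiBeta.fourierApprox n (PsiBeta.classC ψ β 1) ≤ ENNReal.ofReal (K₁ * ψ n * n) := by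
  obtain ⟨C, hC, htail⟩ := PsiBeta.exists_tail_bound hψ.1 hψ.2
  obtain ⟨hpos, hdec, K, hK, hdbl⟩ := hψ.1
  have hposN : ∀ k : ℕ, 1 ≤ k → 0 < ψ k := fun k hk => hpos k (by exact_mod_cast hk)
  have hs := (htail 1 le_rfl).1
  have hpi := pi_pos
  -- The `2` counts cosine and sine coefficients; the second constant is the duality bound with `c =
  -- ψ n / K ^ 2`.
  refine ⟨2 * C, (8 * π * K ^ 2)⁻¹, by positivity, by positivity, fun β n hn =>
    ⟨?_, PsiBeta.bestApprox_le_fourierApprox n _, ?_⟩⟩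
  · have hn1 : (1 : ℝ) ≤ n := by exact_mod_cast hn
    have h := PsiBeta.ofReal_le_bestApprox hposN hs β hn (c := ψ n / K ^ 2)
      (div_nonneg (hposN n hn).le (by positivity)) fun k hk1 hk2 => by
        have hk1' : (n : ℝ) ≤ k := by exact_mod_cast hk1
        have hk2' : (k : ℝ) ≤ 3 * n := by exact_mod_cast hk2
        rw [div_le_iff₀ (by positivity), mul_comm]
        exact PsiBeta.le_sq_mul_of_mem_setB hK hpos hdec hdbl hn1 hk1' (by linarith)
    refine le_trans (le_of_eq ?_) h
    congr 1
    field_simp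
  · refine (PsiBeta.fourierApprox_le hposN hs β hn).trans (ENNReal.ofReal_le_ofReal ?_)
    have := (htail n hn).2
    linarith
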